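/- Let $\mathcal{T}$ be a triangulated category and let $\mathcal{A}\subset\mathcal{T}$ be a full additive subcategory, closed under extensions, such that $\operatorname{Hom}_{\mathcal{T}}(A,B[-1])=0$ for all $A,B\in\mathcal{A}$ (for example, the heart of a t-structure). A pair of morphisms $B\to X\to A$ in $\mathcal{A}$ is called a conflation $0\to B\to X\to A\to 0$ if it is part of a distinguished triangle $B\to X\to A\xrightarrow{\delta}B[1]$ of $\mathcal{T}$. For $n\ge 1$, an $n$-extension of $A$ by $B$ is a sequence $0\to B\to X_1\to\dots\to X_n\to A\to 0$ in $\mathcal{A}$ obtained by splicing conflations $0\to C_{i-1}\to X_i\to C_i\to 0$ $(1\le i\le n)$ with $C_0=B$, $C_n=A$, and $\operatorname{Ext}^n_{\mathcal{A}}(A,B)$ is the set of $n$-extensions modulo the equivalence relation generated by morphisms of sequences that are the identity on $A$ and on $B$; moreover $\operatorname{Ext}^0_{\mathcal{A}}(A,B)=\operatorname{Hom}_{\mathcal{A}}(A,B)$. The Yoneda product $\operatorname{Ext}^n_{\mathcal{A}}(A,B)\times\operatorname{Ext}^m_{\mathcal{A}}(B,C)\to\operatorname{Ext}^{n+m}_{\mathcal{A}}(A,C)$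 is given by splicing if $n,m\ge1$, by pushout along $B\to C$ if $m=0<n$, by pullback along $A\to B$ if $n=0<m$, and by composition if $n=m=0$. The Baer sum is $\mathbf{X}+\mathbf{Y}=\nabla_B\cdot(\mathbf{X}\oplus\mathbf{Y})\cdot\Delta_A$, with $\Delta_A:A\to A\oplus A$ the diagonal and $\nabla_B:B\oplus B\to B$ the codiagonal. Then, for all $n\ge0$ and $A,B\in\mathcal{A}$, there is a well-defined map $f_{n,A,B}:\operatorname{Ext}^n_{\mathcal{A}}(A,B)\to\operatorname{Hom}_{\mathcal{T}}(A,B[n])$ which is the identification $\operatorname{Hom}_{\mathcal{A}}(A,B)=\operatorname{Hom}_{\mathcal{T}}(A,B)$ for $n=0$ and which, for $n\ge1$, sends the class of an $n$-extension as above to the composition $A\to C_{n-1}[1]\to\dots\to C_1[n-1]\to B[n]$ of the shifts of the morphisms $\delta_i:C_i\to C_{i-1}[1]$ of the corresponding distinguished triangles. The following hold. 1. The image of $f_{n,A,B}$ consists of all morphisms $A\to B[n]$ that factor as $A\to C_{n-1}[1]\to\dots\to C_1[n-1]\to B[n]$ for some $C_1,\dots,C_{n-1}\in\mathcal{A}$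 (for $n\le 1$ this is no condition). 2. The maps $f_{n,A,B}$ send the Yoneda product to composition, i.e. the product of $x\in\operatorname{Ext}^n_{\mathcal{A}}(A,B)$ and $y\in\operatorname{Ext}^m_{\mathcal{A}}(B,C)$ is sent to $f_{m,B,C}(y)[n]\circ f_{n,A,B}(x)$. In particular $f_{n,-,-}$ is natural in both variables; the Baer sum makes $\operatorname{Ext}^n_{\mathcal{A}}(A,B)$ an abelian group and $f_{n,A,B}$ is a group homomorphism. 3. Let $n\ge1$ and $A\in\mathcal{A}$. If $f_{n-1,A,B}$ is bijective for every $B\in\mathcal{A}$, then $f_{n,A,B}$ is injective for every $B\in\mathcal{A}$. 4. Let $g_{n,A,B}:\operatorname{Ext}^n_{\mathcal{A}}(A,B)\to\operatorname{Hom}_{\mathcal{T}}(A,B[n])$ be maps, for all $n\ge0$ and $A,B\in\mathcal{A}$, that send the Yoneda product to composition and such that $g_{1,A,B}$ sends the class of each conflation $0\to B\to X\to A\to0$ to the morphism $\delta:A\to B[1]$ of its distinguished triangle. Then $g_{n,A,B}=f_{n,A,B}$ for all $n\ge1$ and $A,B\in\mathcal{A}$. -/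

import Mathlib

open CategoryTheory CategoryTheory.Limits CategoryTheory.Pretriangulated

universe v u

namespace YonedaTriangulated

variable {T : Type u} [Category.{v} T] [Preadditive T] [HasZeroObject T] [HasShift T ℤ]
  [∀ n : ℤ, (shiftFunctor T n).Additive] [Pretriangulated T]

/-- `P` is (the class of objects of) a full, additive, extension-closed subcategory of the
triangulated category `T` such that `Hom(A, B[-1]) = 0` for all objects `A`, `B` of it.
(Closure under finite direct sums follows from extension-closure.) -/
class IsExactSubcategory (P : ObjectProperty T) : Prop extends
    P.ContainsZero, P.IsClosedUnderIsomorphisms, P.IsTriangulatedClosed₂ where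
  hom_neg_one : ∀ {A B : T}, P A → P B → ∀ f : A ⟶ B⟦(-1 : ℤ)⟧, f = 0

variable {P : ObjectProperty T}

/-- A conflation `0 ⟶ B ⟶ X ⟶ A ⟶ 0` in the full subcategory `P`: a pair of morphisms which is part
of a distinguished triangle `B ⟶ X ⟶ A ⟶ B[1]` of `T`. The subcategory being full, morphisms of `P`
are morphisms of `T`. The third morphism is recorded, but equivalence of extensions (see
`NExtension.Maps`) ignores it. -/
structure Conflation (B X A : P.FullSubcategory) where
  i : B.obj ⟶ X.obj
  p : X.obj ⟶ A.obj
  δ : A.obj ⟶ B.obj⟦(1 : ℤ)⟧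
  distinguished : Triangle.mk i p δ ∈ distTriang T

/-- `NExtension k A B` is the type of `(k+1)`-extensions
`0 ⟶ B ⟶ X₁ ⟶ ⋯ ⟶ X_{k+1} ⟶ A ⟶ 0` in the exact category `P`, obtained by splicing `k+1` conflations
`0 ⟶ B ⟶ X₁ ⟶ C₁ ⟶ 0`, `0 ⟶ C₁ ⟶ X₂ ⟶ C₂ ⟶ 0`, ..., `0 ⟶ C_k ⟶ X_{k+1} ⟶ A ⟶ 0`. -/
inductive NExtension : ℕ → P.FullSubcategory → P.FullSubcategory → Type (max u v)
  | single {A B X : P.FullSubcategory} (c : Conflation B X A) : NExtension 0 A B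
  | cons {k : ℕ} {A B X C : P.FullSubcategory} (c : Conflation B X C) (E : NExtension k A C) :
      NExtension (k + 1) A B

namespace NExtension

/-- Given extensions `E`, `E'` of `A` by `B`, `B'` and morphisms `w : W ⟶ B`, `w' : W ⟶ B'`, there is
a family of morphisms `ψᵢ : Xᵢ ⟶ X'ᵢ` such that all the squares
`Xᵢ ⟶ X_{i+1}`, `X'ᵢ ⟶ X'_{i+1}` commute, such that `X_{k+1} ⟶ X'_{k+1} ⟶ A` is `X_{k+1} ⟶ A`, and
such that `W ⟶ B ⟶ X₁ ⟶ X'₁` equals `W ⟶ B' ⟶ X'₁`. -/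
def MapsUnder : {k : ℕ} → {A B B' : P.FullSubcategory} → NExtension k A B → NExtension k A B' →
    {W : T} → (W ⟶ B.obj) → (W ⟶ B'.obj) → Prop
  | _, _, _, _, single (X := X) c, single (X := X') c', _, w, w' =>
      ∃ ψ : X.obj ⟶ X'.obj, w ≫ c.i ≫ ψ = w' ≫ c'.i ∧ ψ ≫ c'.p = c.p
  | _, _, _, _, cons (X := X) c E, cons (X := X') c' E', _, w, w' =>
      ∃ ψ : X.obj ⟶ X'.obj, w ≫ c.i ≫ ψ = w' ≫ c'.i ∧ MapsUnder E E' c.p (ψ ≫ c'.p)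

/-- There is a morphism of exact sequences `E ⟶ E'` which is the identity on both ends. -/
def Maps {k : ℕ} {A B : P.FullSubcategory} (E E' : NExtension k A B) : Prop :=
  MapsUnder E E' (𝟙 B.obj) (𝟙 B.obj)

/-- The composition `A ⟶ C_k[1] ⟶ ⋯ ⟶ C₁[k] ⟶ B[k+1]` of the shifts of the third morphisms of the
distinguished triangles attached to the conflations of an extension. -/
noncomputable def toHom : {k : ℕ} → {A B : P.FullSubcategory} → NExtension k A B →
    ShiftedHom A.obj B.obj ((k + 1 : ℕ) : ℤ)
  | _, _, _, single c => c.δ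
  | _, _, _, cons c E => E.toHom.comp c.δ (by push_cast; ring)

end NExtension

/-- The Yoneda extensions `Ext^n(A, B)` of the exact category `P`: morphisms for `n = 0`, and
`n`-extensions modulo the equivalence relation generated by `NExtension.Maps` for `n > 0`. -/
def YonedaExt : ℕ → P.FullSubcategory → P.FullSubcategory → Type (max u v)
  | 0, A, B => ULift.{u} (A.obj ⟶ B.obj)
  | k + 1, A, B => Quot (NExtension.Maps (k := k) (A := A) (B := B))

namespace YonedaExt

/-- The element of `Ext^0(A, B)` given by a morphism. -/
def ofHom {A B : P.FullSubcategory} (φ : A.obj ⟶ B.obj) : YonedaExt 0 A B := ULift.up φ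

/-- The class of an extension. -/
def mk {k : ℕ} {A B : P.FullSubcategory} (E : NExtension k A B) : YonedaExt (k + 1) A B :=
  Quot.mk _ E

end YonedaExt

/-! ### Pushouts, pullbacks and direct sums of conflations -/

namespace Conflation

variable {A B X : P.FullSubcategory} (c : Conflation B X A)

lemma i_p : c.i ≫ c.p = 0 := comp_distTriang_mor_zero₁₂ _ c.distinguished

lemma i_p_assoc {W : T} (f : A.obj ⟶ W) :
    c.i ≫ c.p ≫ f = 0 ≫ f := by
  rw [← Category.assoc, c.i_p]

lemma δ_i : c.δ ≫ c.i⟦(1 : ℤ)⟧' = 0 := comp_distTriang_mor_zero₃₁ _ c.distinguished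

lemma δ_i_assoc {W : T} (f : X.obj⟦(1 : ℤ)⟧ ⟶ W) :
    c.δ ≫ c.i⟦(1 : ℤ)⟧' ≫ f = 0 ≫ f := by
  rw [← Category.assoc, c.δ_i]

lemma p_δ : c.p ≫ c.δ = 0 := comp_distTriang_mor_zero₂₃ _ c.distinguished

lemma exists_eq_p_comp {W : T} (f : X.obj ⟶ W) (hf : c.i ≫ f = 0) :
    ∃ k : A.obj ⟶ W, f = c.p ≫ k :=
  Triangle.yoneda_exact₂ _ c.distinguished f hf

lemma exists_eq_δ_comp {W : T} (f : A.obj ⟶ W) (hf : c.p ≫ f = 0) :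
    ∃ k : B.obj⟦(1 : ℤ)⟧ ⟶ W, f = c.δ ≫ k :=
  Triangle.yoneda_exact₃ _ c.distinguished f hf

lemma exists_eq_i_comp {W : T} (f : B.obj ⟶ W) (hf : c.δ ≫ f⟦(1 : ℤ)⟧' = 0) :
    ∃ k : X.obj ⟶ W, f = c.i ≫ k := by
  obtain ⟨z, hz⟩ : ∃ z : X.obj⟦(1 : ℤ)⟧ ⟶ W⟦(1 : ℤ)⟧, f⟦(1 : ℤ)⟧' = (-(c.i⟦(1 : ℤ)⟧')) ≫ z :=
    Triangle.yoneda_exact₂ _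
      (rot_of_distTriang _ (rot_of_distTriang _ c.distinguished)) (f⟦(1 : ℤ)⟧') hf
  obtain ⟨k, rfl⟩ := (shiftFunctor T (1 : ℤ)).map_surjective z
  refine ⟨-k, (shiftFunctor T (1 : ℤ)).map_injective ?_⟩
  rw [hz]
  simp

lemma exists_eq_comp_i {W : T} (f : W ⟶ X.obj) (hf : f ≫ c.p = 0) :
    ∃ k : W ⟶ B.obj, f = k ≫ c.i :=
  Triangle.coyoneda_exact₂ _ c.distinguished f hf

lemma exists_eq_comp_p {W : T} (f : W ⟶ A.obj) (hf : f ≫ c.δ = 0) :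
    ∃ k : W ⟶ X.obj, f = k ≫ c.p :=
  Triangle.coyoneda_exact₃ _ c.distinguished f hf

lemma exists_eq_comp_δ {W : T} (f : W ⟶ B.obj⟦(1 : ℤ)⟧) (hf : f ≫ c.i⟦(1 : ℤ)⟧' = 0) :
    ∃ k : W ⟶ A.obj, f = k ≫ c.δ :=
  Triangle.coyoneda_exact₁ _ c.distinguished f hf

/-- A commutative square out of a conflation can be completed: functoriality of the cone. -/
lemma exists_map_of_δ {A' B' X' : P.FullSubcategory} (c' : Conflation B' X' A')
    (g : B.obj ⟶ B'.obj) (a : A.obj ⟶ A'.obj) (h : c.δ ≫ g⟦(1 : ℤ)⟧' = a ≫ c'.δ) :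
    ∃ φ : X.obj ⟶ X'.obj, c.i ≫ φ = g ≫ c'.i ∧ φ ≫ c'.p = c.p ≫ a := by
  obtain ⟨φ, h₁, h₂⟩ :=
    complete_distinguished_triangle_morphism₂ _ _ c.distinguished c'.distinguished g a h
  exact ⟨φ, h₁, h₂.symm⟩

end Conflation

section

variable [IsExactSubcategory P]

lemma hom_shift_one_eq_zero {A B : T} (hA : P A) (hB : P B) (f : A⟦(1 : ℤ)⟧ ⟶ B) : f = 0 := by
  apply (shiftFunctor T (-1 : ℤ)).map_injective
  rw [Functor.map_zero, ← cancel_epi ((shiftFunctorCompIsoId T (1 : ℤ) (-1) (by simp)).inv.app A),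
    comp_zero]
  exact IsExactSubcategory.hom_neg_one hA hB _

lemma exists_conflation {A B : P.FullSubcategory} (δ : A.obj ⟶ B.obj⟦(1 : ℤ)⟧) :
    ∃ (X : P.FullSubcategory) (c : Conflation B X A), c.δ = δ := by
  obtain ⟨X, hX, i, p, h⟩ := P.distinguished_cocone_triangle₂ δ B.property A.property
  exact ⟨⟨X, hX⟩, ⟨i, p, δ, h⟩, rfl⟩

namespace Conflation

variable {A B X : P.FullSubcategory} (c : Conflation B X A)

lemma eq_zero_of_comp_i {W : P.FullSubcategory} (f : W.obj ⟶ B.obj) (hf : f ≫ c.i = 0) :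
    f = 0 := by
  obtain ⟨k, hk⟩ := c.exists_eq_comp_δ (f⟦(1 : ℤ)⟧') (by rw [← Functor.map_comp, hf]; simp)
  have hk0 : k = 0 := hom_shift_one_eq_zero W.property A.property k
  apply (shiftFunctor T (1 : ℤ)).map_injective
  rw [hk, hk0, zero_comp, Functor.map_zero]

lemma eq_zero_of_p_comp {W : P.FullSubcategory} (f : A.obj ⟶ W.obj) (hf : c.p ≫ f = 0) :
    f = 0 := by
  obtain ⟨k, hk⟩ := c.exists_eq_δ_comp f hf
  rw [hk, hom_shift_one_eq_zero B.property W.property k, comp_zero]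

lemma exists_push {C : P.FullSubcategory} (g : B.obj ⟶ C.obj) :
    ∃ (Z : P.FullSubcategory) (d : Conflation C Z A) (φ : X.obj ⟶ Z.obj),
      c.i ≫ φ = g ≫ d.i ∧ φ ≫ d.p = c.p ∧ d.δ = c.δ ≫ g⟦(1 : ℤ)⟧' := by
  obtain ⟨Z, d, hd⟩ := exists_conflation (c.δ ≫ g⟦(1 : ℤ)⟧')
  obtain ⟨φ, h₁, h₂⟩ := c.exists_map_of_δ d g (𝟙 _) (by rw [hd, Category.id_comp])
  exact ⟨Z, d, φ, h₁, by simpa using h₂, hd⟩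

/-- The middle term `g · X` of the conflation `g · c`; see `isPushout`. -/
noncomputable def pushObj {C : P.FullSubcategory} (g : B.obj ⟶ C.obj) : P.FullSubcategory :=
  (c.exists_push g).choose

/-- The conflation `g · c : 0 ⟶ C ⟶ g · X ⟶ A ⟶ 0` for `c : 0 ⟶ B ⟶ X ⟶ A ⟶ 0` and `g : B ⟶ C`,
where `g · X` is the pushout of `g` and `B ⟶ X`. -/
noncomputable def push {C : P.FullSubcategory} (g : B.obj ⟶ C.obj) :
    Conflation C (c.pushObj g) A :=
  (c.exists_push g).choose_spec.choose

/-- The morphism `X ⟶ g · X`. -/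
noncomputable def toPush {C : P.FullSubcategory} (g : B.obj ⟶ C.obj) :
    X.obj ⟶ (c.pushObj g).obj :=
  (c.exists_push g).choose_spec.choose_spec.choose

lemma i_toPush {C : P.FullSubcategory} (g : B.obj ⟶ C.obj) :
    c.i ≫ c.toPush g = g ≫ (c.push g).i :=
  (c.exists_push g).choose_spec.choose_spec.choose_spec.1

lemma i_toPush_assoc {C : P.FullSubcategory} (g : B.obj ⟶ C.obj) {W : T}
    (f : (c.pushObj g).obj ⟶ W) :
    c.i ≫ c.toPush g ≫ f = g ≫ (c.push g).i ≫ f := by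
  rw [← Category.assoc, c.i_toPush g, Category.assoc]

lemma toPush_p {C : P.FullSubcategory} (g : B.obj ⟶ C.obj) :
    c.toPush g ≫ (c.push g).p = c.p :=
  (c.exists_push g).choose_spec.choose_spec.choose_spec.2.1

lemma toPush_p_assoc {C : P.FullSubcategory} (g : B.obj ⟶ C.obj) {W : T}
    (f : A.obj ⟶ W) :
    c.toPush g ≫ (c.push g).p ≫ f = c.p ≫ f := by
  rw [← Category.assoc, c.toPush_p g]

lemma push_δ {C : P.FullSubcategory} (g : B.obj ⟶ C.obj) :
    (c.push g).δ = c.δ ≫ g⟦(1 : ℤ)⟧' :=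
  (c.exists_push g).choose_spec.choose_spec.choose_spec.2.2

lemma push_hom_ext {C W : P.FullSubcategory} (g : B.obj ⟶ C.obj)
    {a b : (c.pushObj g).obj ⟶ W.obj} (h₁ : (c.push g).i ≫ a = (c.push g).i ≫ b)
    (h₂ : c.toPush g ≫ a = c.toPush g ≫ b) : a = b := by
  obtain ⟨k, hk⟩ := (c.push g).exists_eq_p_comp (a - b) (by rw [Preadditive.comp_sub, h₁, sub_self])
  have hk0 : k = 0 := c.eq_zero_of_p_comp k (by
    rw [← c.toPush_p g, Category.assoc, ← hk, Preadditive.comp_sub, h₂, sub_self])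
  rw [hk0, comp_zero] at hk
  exact sub_eq_zero.1 hk

lemma push_exists_desc {C W : P.FullSubcategory} (g : B.obj ⟶ C.obj)
    (a : C.obj ⟶ W.obj) (b : X.obj ⟶ W.obj) (h : g ≫ a = c.i ≫ b) :
    ∃ z : (c.pushObj g).obj ⟶ W.obj, (c.push g).i ≫ z = a ∧ c.toPush g ≫ z = b := by
  obtain ⟨z, hz⟩ := (c.push g).exists_eq_i_comp a (by
    rw [push_δ, Category.assoc, ← Functor.map_comp, h, Functor.map_comp, δ_i_assoc, zero_comp])
  obtain ⟨k, hk⟩ := c.exists_eq_p_comp (c.toPush g ≫ z - b) (by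
    rw [Preadditive.comp_sub, i_toPush_assoc, ← hz, h, sub_self])
  refine ⟨z - (c.push g).p ≫ k, ?_, ?_⟩
  · rw [Preadditive.comp_sub, i_p_assoc, zero_comp, sub_zero, hz]
  · rw [Preadditive.comp_sub, toPush_p_assoc, ← hk, sub_sub_cancel]

/-- In the category `P`, the object `g · X` is the pushout of `g` and `B ⟶ X`. -/
lemma isPushout {C : P.FullSubcategory} (g : B ⟶ C) :
    IsPushout (C := P.FullSubcategory) g (ObjectProperty.homMk c.i)
      (ObjectProperty.homMk (c.push g.hom).i) (ObjectProperty.homMk (c.toPush g.hom)) where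
  w := by ext; exact (c.i_toPush g.hom).symm
  isColimit' := ⟨PushoutCocone.IsColimit.mk _
    (fun s => ObjectProperty.homMk (c.push_exists_desc g.hom s.inl.hom s.inr.hom
      (congrArg InducedCategory.Hom.hom s.condition)).choose)
    (fun s => by
      ext
      exact (c.push_exists_desc g.hom s.inl.hom s.inr.hom
        (congrArg InducedCategory.Hom.hom s.condition)).choose_spec.1)
    (fun s => by
      ext
      exact (c.push_exists_desc g.hom s.inl.hom s.inr.hom
        (congrArg InducedCategory.Hom.hom s.condition)).choose_spec.2)
    (fun s m h₁ h₂ => by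
      have h := (c.push_exists_desc g.hom s.inl.hom s.inr.hom
        (congrArg InducedCategory.Hom.hom s.condition)).choose_spec
      ext
      exact c.push_hom_ext g.hom ((congrArg InducedCategory.Hom.hom h₁).trans h.1.symm)
        ((congrArg InducedCategory.Hom.hom h₂).trans h.2.symm))⟩

lemma exists_pull {A' : P.FullSubcategory} (a : A'.obj ⟶ A.obj) :
    ∃ (Z : P.FullSubcategory) (d : Conflation B Z A') (φ : Z.obj ⟶ X.obj),
      d.i ≫ φ = c.i ∧ φ ≫ c.p = d.p ≫ a ∧ d.δ = a ≫ c.δ := by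
  obtain ⟨Z, d, hd⟩ := exists_conflation (a ≫ c.δ)
  obtain ⟨φ, h₁, h₂⟩ := d.exists_map_of_δ c (𝟙 _) a (by rw [hd]; simp)
  exact ⟨Z, d, φ, by simpa using h₁, h₂, hd⟩

/-- The middle term `X · a` of the conflation `c · a`; see `isPullback`. -/
noncomputable def pullObj {A' : P.FullSubcategory} (a : A'.obj ⟶ A.obj) : P.FullSubcategory :=
  (c.exists_pull a).choose

/-- The conflation `c · a : 0 ⟶ B ⟶ X · a ⟶ A' ⟶ 0` for `c : 0 ⟶ B ⟶ X ⟶ A ⟶ 0` and `a : A' ⟶ A`,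
where `X · a` is the pullback of `a` and `X ⟶ A`. -/
noncomputable def pull {A' : P.FullSubcategory} (a : A'.obj ⟶ A.obj) :
    Conflation B (c.pullObj a) A' :=
  (c.exists_pull a).choose_spec.choose

/-- The morphism `X · a ⟶ X`. -/
noncomputable def fromPull {A' : P.FullSubcategory} (a : A'.obj ⟶ A.obj) :
    (c.pullObj a).obj ⟶ X.obj :=
  (c.exists_pull a).choose_spec.choose_spec.choose

lemma i_fromPull {A' : P.FullSubcategory} (a : A'.obj ⟶ A.obj) :
    (c.pull a).i ≫ c.fromPull a = c.i :=
  (c.exists_pull a).choose_spec.choose_spec.choose_spec.1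

lemma i_fromPull_assoc {A' : P.FullSubcategory} (a : A'.obj ⟶ A.obj) {W : T}
    (f : X.obj ⟶ W) :
    (c.pull a).i ≫ c.fromPull a ≫ f = c.i ≫ f := by
  rw [← Category.assoc, c.i_fromPull a]

lemma fromPull_p {A' : P.FullSubcategory} (a : A'.obj ⟶ A.obj) :
    c.fromPull a ≫ c.p = (c.pull a).p ≫ a :=
  (c.exists_pull a).choose_spec.choose_spec.choose_spec.2.1

lemma pull_δ {A' : P.FullSubcategory} (a : A'.obj ⟶ A.obj) :
    (c.pull a).δ = a ≫ c.δ :=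
  (c.exists_pull a).choose_spec.choose_spec.choose_spec.2.2

lemma pull_exists_lift {A' W : P.FullSubcategory} (a : A'.obj ⟶ A.obj)
    (x : W.obj ⟶ A'.obj) (y : W.obj ⟶ X.obj) (h : x ≫ a = y ≫ c.p) :
    ∃ z : W.obj ⟶ (c.pullObj a).obj, z ≫ (c.pull a).p = x ∧ z ≫ c.fromPull a = y := by
  obtain ⟨z, hz⟩ := (c.pull a).exists_eq_comp_p x (by
    rw [pull_δ, reassoc_of% h, p_δ, comp_zero])
  obtain ⟨k, hk⟩ := c.exists_eq_comp_i (z ≫ c.fromPull a - y) (by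
    rw [Preadditive.sub_comp, Category.assoc, fromPull_p, ← reassoc_of% hz, h, sub_self])
  refine ⟨z - k ≫ (c.pull a).i, ?_, ?_⟩
  · rw [Preadditive.sub_comp, Category.assoc, i_p, comp_zero, sub_zero, hz]
  · rw [Preadditive.sub_comp, Category.assoc, i_fromPull, ← hk, sub_sub_cancel]

/-- The middle term of a pullback conflation is a pullback, so morphisms into it are determined by
their components. -/
lemma pull_hom_ext {A' W : P.FullSubcategory} (a : A'.obj ⟶ A.obj)
    {x y : W.obj ⟶ (c.pullObj a).obj} (h₁ : x ≫ (c.pull a).p = y ≫ (c.pull a).p)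
    (h₂ : x ≫ c.fromPull a = y ≫ c.fromPull a) : x = y := by
  obtain ⟨k, hk⟩ := (c.pull a).exists_eq_comp_i (x - y) (by
    rw [Preadditive.sub_comp, h₁, sub_self])
  have hk0 : k = 0 := c.eq_zero_of_comp_i k (by
    rw [← c.i_fromPull a, ← Category.assoc, ← hk, Preadditive.sub_comp, h₂, sub_self])
  rw [hk0, zero_comp] at hk
  exact sub_eq_zero.1 hk

/-- In the category `P`, the object `X · a` is the pullback of `a` and `X ⟶ A`. -/
lemma isPullback {A' : P.FullSubcategory} (a : A' ⟶ A) :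
    IsPullback (C := P.FullSubcategory) (ObjectProperty.homMk (c.pull a.hom).p)
      (ObjectProperty.homMk (c.fromPull a.hom)) a (ObjectProperty.homMk c.p) where
  w := by ext; exact (c.fromPull_p a.hom).symm
  isLimit' := ⟨PullbackCone.IsLimit.mk _
    (fun s => ObjectProperty.homMk (c.pull_exists_lift a.hom s.fst.hom s.snd.hom
      (congrArg InducedCategory.Hom.hom s.condition)).choose)
    (fun s => by
      ext
      exact (c.pull_exists_lift a.hom s.fst.hom s.snd.hom
        (congrArg InducedCategory.Hom.hom s.condition)).choose_spec.1)
    (fun s => by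
      ext
      exact (c.pull_exists_lift a.hom s.fst.hom s.snd.hom
        (congrArg InducedCategory.Hom.hom s.condition)).choose_spec.2)
    (fun s m h₁ h₂ => by
      have h := (c.pull_exists_lift a.hom s.fst.hom s.snd.hom
        (congrArg InducedCategory.Hom.hom s.condition)).choose_spec
      ext
      exact c.pull_hom_ext a.hom ((congrArg InducedCategory.Hom.hom h₁).trans h.1.symm)
        ((congrArg InducedCategory.Hom.hom h₂).trans h.2.symm))⟩

end Conflation

/-- The direct sum of two objects of `P`. -/
noncomputable def dsum (A B : P.FullSubcategory) : P.FullSubcategory where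
  obj := A.obj ⊞ B.obj
  property := P.ext_of_isTriangulatedClosed₂ _
    (binaryBiproductTriangle_distinguished A.obj B.obj) A.property B.property

end

lemma exists_biprod_iso_pi (Y : Bool → T) : ∃ e : Y true ⊞ Y false ≅ ∏ᶜ Y,
    e.hom ≫ Pi.π Y true = biprod.fst ∧ e.hom ≫ Pi.π Y false = biprod.snd := by
  refine ⟨{ hom := Pi.lift (fun j => match j with
              | true => biprod.fst
              | false => biprod.snd)
            inv := biprod.lift (Pi.π Y true) (Pi.π Y false)
            hom_inv_id := ?_
            inv_hom_id := ?_ }, ?_, ?_⟩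
  · ext <;> simp
  · refine Pi.hom_ext _ _ ?_
    rintro (_ | _) <;> simp
  · simp
  · simp

/-- The direct sum of two morphisms `A ⟶ B[1]`, `A' ⟶ B'[1]`, as a morphism
`A ⊞ A' ⟶ (B ⊞ B')[1]`. -/
noncomputable def biprodδ {A B A' B' : T} (δ : A ⟶ B⟦(1 : ℤ)⟧) (δ' : A' ⟶ B'⟦(1 : ℤ)⟧) :
    A ⊞ A' ⟶ (B ⊞ B')⟦(1 : ℤ)⟧ :=
  biprod.desc (δ ≫ (biprod.inl : B ⟶ B ⊞ B')⟦(1 : ℤ)⟧') (δ' ≫ (biprod.inr : B' ⟶ B ⊞ B')⟦(1 : ℤ)⟧')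

lemma biprodδ_fst {A B A' B' : T} (δ : A ⟶ B⟦(1 : ℤ)⟧) (δ' : A' ⟶ B'⟦(1 : ℤ)⟧) :
    biprodδ δ δ' ≫ (biprod.fst : B ⊞ B' ⟶ B)⟦(1 : ℤ)⟧' = biprod.fst ≫ δ := by
  ext <;> simp [biprodδ, ← Functor.map_comp]

lemma biprodδ_snd {A B A' B' : T} (δ : A ⟶ B⟦(1 : ℤ)⟧) (δ' : A' ⟶ B'⟦(1 : ℤ)⟧) :
    biprodδ δ δ' ≫ (biprod.snd : B ⊞ B' ⟶ B')⟦(1 : ℤ)⟧' = biprod.snd ≫ δ' := by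
  ext <;> simp [biprodδ, ← Functor.map_comp]

lemma biprod_distinguished {A B X A' B' X' : T} {i : B ⟶ X} {p : X ⟶ A} {δ : A ⟶ B⟦(1 : ℤ)⟧}
    {i' : B' ⟶ X'} {p' : X' ⟶ A'} {δ' : A' ⟶ B'⟦(1 : ℤ)⟧}
    (h : Triangle.mk i p δ ∈ distTriang T) (h' : Triangle.mk i' p' δ' ∈ distTriang T) :
    Triangle.mk (biprod.map i i') (biprod.map p p') (biprodδ δ δ') ∈ distTriang T := by
  let F : Bool → Triangle T := fun j => match j with
    | true => Triangle.mk i p δ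
    | false => Triangle.mk i' p' δ'
  have hF : ∀ j, F j ∈ distTriang T := by rintro (_ | _) <;> assumption
  have hprod := productTriangle_distinguished F hF
  obtain ⟨e₁, h₁, h₁'⟩ : ∃ e : B ⊞ B' ≅ ∏ᶜ (fun j => (F j).obj₁),
      e.hom ≫ Pi.π _ true = (biprod.fst : B ⊞ B' ⟶ B) ∧
      e.hom ≫ Pi.π _ false = (biprod.snd : B ⊞ B' ⟶ B') :=
    exists_biprod_iso_pi (fun j => (F j).obj₁)
  obtain ⟨e₂, h₂, h₂'⟩ : ∃ e : X ⊞ X' ≅ ∏ᶜ (fun j => (F j).obj₂),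
      e.hom ≫ Pi.π _ true = (biprod.fst : X ⊞ X' ⟶ X) ∧
      e.hom ≫ Pi.π _ false = (biprod.snd : X ⊞ X' ⟶ X') :=
    exists_biprod_iso_pi (fun j => (F j).obj₂)
  obtain ⟨e₃, h₃, h₃'⟩ : ∃ e : A ⊞ A' ≅ ∏ᶜ (fun j => (F j).obj₃),
      e.hom ≫ Pi.π _ true = (biprod.fst : A ⊞ A' ⟶ A) ∧
      e.hom ≫ Pi.π _ false = (biprod.snd : A ⊞ A' ⟶ A') :=
    exists_biprod_iso_pi (fun j => (F j).obj₃)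
  refine isomorphic_distinguished _ hprod _ (Triangle.isoMk _ _ e₁ e₂ e₃ ?_ ?_ ?_)
  · change biprod.map i i' ≫ e₂.hom = e₁.hom ≫ Limits.Pi.map (fun j => (F j).mor₁)
    refine Pi.hom_ext _ _ ?_
    rintro (_ | _)
    · rw [Category.assoc, Category.assoc, Limits.Pi.map_π, h₂', reassoc_of% h₁']
      exact biprod.map_snd _ _
    · rw [Category.assoc, Category.assoc, Limits.Pi.map_π, h₂, reassoc_of% h₁]
      exact biprod.map_fst _ _
  · change biprod.map p p' ≫ e₃.hom = e₂.hom ≫ Limits.Pi.map (fun j => (F j).mor₂)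
    refine Pi.hom_ext _ _ ?_
    rintro (_ | _)
    · rw [Category.assoc, Category.assoc, Limits.Pi.map_π, h₃', reassoc_of% h₂']
      exact biprod.map_snd _ _
    · rw [Category.assoc, Category.assoc, Limits.Pi.map_π, h₃, reassoc_of% h₂]
      exact biprod.map_fst _ _
  · change biprodδ δ δ' ≫ e₁.hom⟦(1 : ℤ)⟧' =
      e₃.hom ≫ Limits.Pi.map (fun j => (F j).mor₃) ≫ inv (piComparison _ _)
    rw [← cancel_mono (piComparison (shiftFunctor T (1 : ℤ)) (fun j => (F j).obj₁))]
    simp only [Category.assoc, IsIso.inv_hom_id, Category.comp_id]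
    refine Pi.hom_ext _ _ ?_
    rintro (_ | _)
    · simp only [Category.assoc, Limits.Pi.map_π, piComparison_comp_π]
      rw [← Functor.map_comp, h₁', reassoc_of% h₃']
      exact biprodδ_snd δ δ'
    · simp only [Category.assoc, Limits.Pi.map_π, piComparison_comp_π]
      rw [← Functor.map_comp, h₁, reassoc_of% h₃]
      exact biprodδ_fst δ δ'

/-- The direct sum of two conflations. -/
noncomputable def Conflation.dsum [IsExactSubcategory P] {A B X A' B' X' : P.FullSubcategory}
    (c : Conflation B X A) (c' : Conflation B' X' A') :
    Conflation (YonedaTriangulated.dsum B B') (YonedaTriangulated.dsum X X')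
      (YonedaTriangulated.dsum A A') where
  i := biprod.map c.i c'.i
  p := biprod.map c.p c'.p
  δ := biprodδ c.δ c'.δ
  distinguished := biprod_distinguished c.distinguished c'.distinguished

/-! ### Operations on extensions -/

namespace NExtension

lemma MapsUnder.precomp {k : ℕ} {A B B' : P.FullSubcategory} {E : NExtension k A B}
    {E' : NExtension k A B'} {W V : T} {w : W ⟶ B.obj} {w' : W ⟶ B'.obj}
    (h : MapsUnder E E' w w') (q : V ⟶ W) : MapsUnder E E' (q ≫ w) (q ≫ w') := by
  cases E with
  | single c =>
    cases E' with
    | single c' =>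
      obtain ⟨ψ, h₁, h₂⟩ := h
      exact ⟨ψ, by simp [h₁], h₂⟩
  | cons c E =>
    cases E' with
    | cons c' E' =>
      obtain ⟨ψ, h₁, h₂⟩ := h
      exact ⟨ψ, by simp [h₁], h₂⟩

lemma MapsUnder.refl {k : ℕ} {A B : P.FullSubcategory} (E : NExtension k A B) {W : T}
    (w : W ⟶ B.obj) : MapsUnder E E w w := by
  induction E generalizing W with
  | single c => exact ⟨𝟙 _, by simp, by simp⟩
  | cons c E ih => exact ⟨𝟙 _, by simp, by simpa using ih c.p⟩

/-- Splicing `E : 0 ⟶ B ⟶ X₁ ⟶ ⋯ ⟶ A ⟶ 0` and `F : 0 ⟶ C ⟶ Y₁ ⟶ ⋯ ⟶ B ⟶ 0` into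
`F · E : 0 ⟶ C ⟶ Y₁ ⟶ ⋯ ⟶ X₁ ⟶ ⋯ ⟶ A ⟶ 0`. The lengths `k+1` and `l+1` add up. -/
def splice {k : ℕ} {A B : P.FullSubcategory} (E : NExtension k A B) :
    {l : ℕ} → {C : P.FullSubcategory} → NExtension l B C → NExtension (k + 1 + l) A C
  | _, _, single c => cons c E
  | _, _, cons c F => cons c (splice E F)

lemma MapsUnder.splice_left {k : ℕ} {A B : P.FullSubcategory} {E E' : NExtension k A B}
    (h : Maps E E') {l : ℕ} {C : P.FullSubcategory} (F : NExtension l B C) {W : T}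
    (w : W ⟶ C.obj) : MapsUnder (splice E F) (splice E' F) w w := by
  induction F generalizing W with
  | single c => exact ⟨𝟙 _, by simp, by simpa using MapsUnder.precomp h c.p⟩
  | cons c F ih => exact ⟨𝟙 _, by simp, by simpa using ih h c.p⟩

lemma MapsUnder.splice_right {k : ℕ} {A B : P.FullSubcategory} (E : NExtension k A B)
    {l : ℕ} {C C' : P.FullSubcategory} {F : NExtension l B C} {F' : NExtension l B C'} {W : T}
    {w : W ⟶ C.obj} {w' : W ⟶ C'.obj} (h : MapsUnder F F' w w') :
    MapsUnder (splice E F) (splice E F') w w' := by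
  induction F generalizing W C' with
  | single c =>
    cases F' with
    | single c' =>
      obtain ⟨ψ, h₁, h₂⟩ := h
      exact ⟨ψ, h₁, by rw [h₂]; exact MapsUnder.refl E _⟩
  | cons c F ih =>
    cases F' with
    | cons c' F' =>
      obtain ⟨ψ, h₁, h₂⟩ := h
      exact ⟨ψ, h₁, ih E h₂⟩

variable [IsExactSubcategory P]

/-- The extension `g · E`, obtained by replacing `0 ⟶ B ⟶ X₁` by `0 ⟶ C ⟶ g · X₁`. -/
noncomputable def push : {k : ℕ} → {A B C : P.FullSubcategory} → (B.obj ⟶ C.obj) →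
    NExtension k A B → NExtension k A C
  | _, _, _, _, g, single c => single (c.push g)
  | _, _, _, _, g, cons c E => cons (c.push g) E

/-- The extension `E · a`, obtained by replacing `X_{k+1} ⟶ A ⟶ 0` by `X_{k+1} · a ⟶ A' ⟶ 0`. -/
noncomputable def pull {A A' : P.FullSubcategory} (a : A'.obj ⟶ A.obj) :
    {k : ℕ} → {B : P.FullSubcategory} → NExtension k A B → NExtension k A' B
  | _, _, single c => single (c.pull a)
  | _, _, cons c E => cons c (pull a E)

/-- The direct sum of two exact sequences. -/
noncomputable def dsum : {k : ℕ} → {A B A' B' : P.FullSubcategory} → NExtension k A B →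
    NExtension k A' B' →
    NExtension k (YonedaTriangulated.dsum A A') (YonedaTriangulated.dsum B B')
  | _, _, _, _, _, single c, single c' => single (c.dsum c')
  | _, _, _, _, _, cons c E, cons c' E' => cons (c.dsum c') (dsum E E')

lemma Maps.push {k : ℕ} {A B C : P.FullSubcategory} (g : B.obj ⟶ C.obj)
    {E E' : NExtension k A B} (h : Maps E E') : Maps (push g E) (push g E') := by
  cases E with
  | single c =>
    cases E' with
    | single c' =>
      obtain ⟨ψ, h₁, h₂⟩ := h
      simp only [Category.id_comp] at h₁
      obtain ⟨z, hz₁, hz₂⟩ := c.push_exists_desc g (c'.push g).i (ψ ≫ c'.toPush g) (by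
        rw [reassoc_of% h₁, c'.i_toPush])
      refine ⟨z, by simp [hz₁], c.push_hom_ext g ?_ ?_⟩
      · rw [reassoc_of% hz₁, Conflation.i_p, Conflation.i_p]
      · rw [reassoc_of% hz₂, Conflation.toPush_p, h₂, Conflation.toPush_p]
  | cons c E =>
    cases E' with
    | cons c' E' =>
      obtain ⟨ψ, h₁, h₂⟩ := h
      simp only [Category.id_comp] at h₁
      obtain ⟨z, hz₁, hz₂⟩ := c.push_exists_desc g (c'.push g).i (ψ ≫ c'.toPush g) (by
        rw [reassoc_of% h₁, c'.i_toPush])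
      refine ⟨z, by simp [hz₁], ?_⟩
      have key : ∀ {Y Y' : P.FullSubcategory} (u : _ ⟶ Y.obj) (u' : _ ⟶ Y'.obj)
          (φ : Y.obj ⟶ Y'.obj), c.p ≫ u ≫ φ = (ψ ≫ c'.p) ≫ u' →
          (c.push g).p ≫ u ≫ φ = (z ≫ (c'.push g).p) ≫ u' := by
        intro Y Y' u u' φ hu
        apply c.push_hom_ext g
        · simp [Conflation.i_p_assoc, reassoc_of% hz₁]
        · simp [Conflation.toPush_p_assoc, hu, reassoc_of% hz₂]
      cases E with
      | single d =>
        cases E' with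
        | single d' =>
          obtain ⟨φ, h₃, h₄⟩ := h₂
          exact ⟨φ, key _ _ _ h₃, h₄⟩
      | cons d E =>
        cases E' with
        | cons d' E' =>
          obtain ⟨φ, h₃, h₄⟩ := h₂
          exact ⟨φ, key _ _ _ h₃, h₄⟩

lemma MapsUnder.pull {A A' : P.FullSubcategory} (a : A'.obj ⟶ A.obj) {k : ℕ}
    {B B' : P.FullSubcategory} {E : NExtension k A B} {E' : NExtension k A B'}
    {W : P.FullSubcategory} {w : W.obj ⟶ B.obj} {w' : W.obj ⟶ B'.obj}
    (h : MapsUnder E E' w w') : MapsUnder (pull a E) (pull a E') w w' := by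
  induction E generalizing W B' with
  | single c =>
    cases E' with
    | single c' =>
      obtain ⟨ψ, h₁, h₂⟩ := h
      obtain ⟨z, hz₁, hz₂⟩ := c'.pull_exists_lift a (c.pull a).p (c.fromPull a ≫ ψ) (by
        rw [Category.assoc, h₂, Conflation.fromPull_p])
      refine ⟨z, c'.pull_hom_ext a ?_ ?_, hz₁⟩
      · simp [hz₁, Conflation.i_p]
      · simp [hz₂, Conflation.i_fromPull, Conflation.i_fromPull_assoc, h₁]
  | cons c E ih =>
    cases E' with
    | cons c' E' =>
      obtain ⟨ψ, h₁, h₂⟩ := h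
      exact ⟨ψ, h₁, ih a h₂⟩

lemma biprod_map_comp {X X' Y Y' Z Z' : T} (a : X ⟶ Y) (b : Y ⟶ Z) (a' : X' ⟶ Y')
    (b' : Y' ⟶ Z') :
    biprod.map a a' ≫ biprod.map b b' = biprod.map (a ≫ b) (a' ≫ b') := by
  ext <;> simp

lemma MapsUnder.dsum {k : ℕ} {A B B' A₁ B₁ B₁' : P.FullSubcategory}
    {E : NExtension k A B} {E' : NExtension k A B'} {F : NExtension k A₁ B₁}
    {F' : NExtension k A₁ B₁'} {W V : T} {w : W ⟶ B.obj} {w' : W ⟶ B'.obj}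
    {v : V ⟶ B₁.obj} {v' : V ⟶ B₁'.obj} (h : MapsUnder E E' w w') (h' : MapsUnder F F' v v') :
    MapsUnder (E.dsum F) (E'.dsum F') (W := W ⊞ V) (biprod.map w v) (biprod.map w' v') := by
  have key : ∀ {X X' Y Y' : T} {B B' B₁ B₁' : T} {W V : T} {w : W ⟶ B} {w' : W ⟶ B'}
      {v : V ⟶ B₁} {v' : V ⟶ B₁'} {i : B ⟶ X} {i' : B' ⟶ X'} {j : B₁ ⟶ Y} {j' : B₁' ⟶ Y'}
      {ψ : X ⟶ X'} {φ : Y ⟶ Y'}, w ≫ i ≫ ψ = w' ≫ i' → v ≫ j ≫ φ = v' ≫ j' →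
      biprod.map w v ≫ biprod.map i j ≫ biprod.map ψ φ = biprod.map w' v' ≫ biprod.map i' j' := by
    intros
    simp only [biprod_map_comp, *]
  induction E generalizing W V B' B₁ B₁' with
  | single c =>
    cases E' with
    | single c' =>
    cases F with
    | single d =>
    cases F' with
    | single d' =>
      obtain ⟨ψ, h₁, h₂⟩ := h
      obtain ⟨φ, h₃, h₄⟩ := h'
      exact ⟨biprod.map ψ φ, key h₁ h₃, (biprod_map_comp ..).trans (by rw [h₂, h₄]; rfl)⟩
  | cons c E ih =>
    cases E' with
    | cons c' E' =>
    cases F with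
    | cons d F =>
    cases F' with
    | cons d' F' =>
      obtain ⟨ψ, h₁, h₂⟩ := h
      obtain ⟨φ, h₃, h₄⟩ := h'
      refine ⟨biprod.map ψ φ, key h₁ h₃, ?_⟩
      have := ih h₂ h₄
      rw [← biprod_map_comp] at this
      exact this

lemma Maps.dsum {k : ℕ} {A B A' B' : P.FullSubcategory} {E E' : NExtension k A B}
    {F F' : NExtension k A' B'} (h : Maps E E') (h' : Maps F F') :
    Maps (E.dsum F) (E'.dsum F') := by
  have := MapsUnder.dsum h h'
  rwa [show biprod.map (𝟙 B.obj) (𝟙 B'.obj) = 𝟙 (B.obj ⊞ B'.obj) by ext <;> simp] at this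

end NExtension

namespace YonedaExt

/-- The Yoneda product of extensions of positive length: `(E, F) ↦ F · E`. -/
def splice {k l : ℕ} {A B C : P.FullSubcategory} (x : YonedaExt (k + 1) A B)
    (y : YonedaExt (l + 1) B C) : YonedaExt (k + 1 + (l + 1)) A C :=
  Quot.map₂ (fun E F => NExtension.splice E F)
    (fun E _ _ h => NExtension.MapsUnder.splice_right E h)
    (fun _ _ F h => NExtension.MapsUnder.splice_left h F _) x y

variable [IsExactSubcategory P]

/-- The Yoneda product `x ↦ g · x` with a morphism `g : B ⟶ C`. -/
noncomputable def push : {n : ℕ} → {A B C : P.FullSubcategory} → (B.obj ⟶ C.obj) →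
    YonedaExt n A B → YonedaExt n A C
  | 0, _, _, _, g, x => ofHom (ULift.down x ≫ g)
  | _ + 1, _, _, _, g, x => Quot.map (NExtension.push g) (fun _ _ h => h.push g) x

/-- The Yoneda product `x ↦ x · a` with a morphism `a : A' ⟶ A`. -/
noncomputable def pull : {n : ℕ} → {A' A B : P.FullSubcategory} → (A'.obj ⟶ A.obj) →
    YonedaExt n A B → YonedaExt n A' B
  | 0, _, _, _, a, x => ofHom (a ≫ ULift.down x)
  | _ + 1, _, _, _, a, x => Quot.map (NExtension.pull a)
      (fun _ _ h => NExtension.MapsUnder.pull (W := _) a h) x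

/-- The Yoneda product `Ext^n(A, B) × Ext^m(B, C) ⟶ Ext^{n+m}(A, C)`, `(x, y) ↦ y · x`. The degree
of the target is any `k` which is equal to `n + m`. -/
noncomputable def prod : {n m k : ℕ} → {A B C : P.FullSubcategory} → YonedaExt n A B →
    YonedaExt m B C → n + m = k → YonedaExt k A C
  | _, 0, _, A, _, C, x, y, h => cast (congrArg (YonedaExt · A C) h) (push (ULift.down y) x)
  | 0, _ + 1, _, A, _, C, x, y, h =>
      cast (congrArg (YonedaExt · A C) ((Nat.zero_add _).symm.trans h)) (pull (ULift.down x) y)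
  | _ + 1, _ + 1, _, A, _, C, x, y, h => cast (congrArg (YonedaExt · A C) h) (splice x y)

/-- The direct sum `Ext^n(A, B) × Ext^n(A', B') ⟶ Ext^n(A ⊕ A', B ⊕ B')`. -/
noncomputable def dsum : {n : ℕ} → {A B A' B' : P.FullSubcategory} → YonedaExt n A B →
    YonedaExt n A' B' →
    YonedaExt n (YonedaTriangulated.dsum A A') (YonedaTriangulated.dsum B B')
  | 0, _, _, _, _, x, y =>
      ofHom (A := YonedaTriangulated.dsum _ _) (B := YonedaTriangulated.dsum _ _)
        (biprod.map (ULift.down x) (ULift.down y))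
  | _ + 1, _, _, _, _, x, y => Quot.map₂ NExtension.dsum
      (fun E _ _ h => NExtension.Maps.dsum (NExtension.MapsUnder.refl E _) h)
      (fun _ _ F h => NExtension.Maps.dsum h (NExtension.MapsUnder.refl F _)) x y

/-- The Baer sum `x + y = ∇_B · (x ⊕ y) · Δ_A`. -/
noncomputable def baerSum {n : ℕ} {A B : P.FullSubcategory} (x y : YonedaExt n A B) :
    YonedaExt n A B :=
  push (B := YonedaTriangulated.dsum B B) (biprod.desc (𝟙 B.obj) (𝟙 B.obj))
    (pull (A := YonedaTriangulated.dsum A A) (biprod.lift (𝟙 A.obj) (𝟙 A.obj)) (dsum x y))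

end YonedaExt

/-- A morphism `A ⟶ B[n]` factors as `A ⟶ C_{n-1}[1] ⟶ ⋯ ⟶ C₁[n-1] ⟶ B[n]` with all `Cᵢ` in `P`
(no condition if `n ≤ 1`, as there are then no intermediate objects). -/
def FactorsThroughShifts {A : P.FullSubcategory} :
    (n : ℕ) → {B : P.FullSubcategory} → (A.obj ⟶ B.obj⟦(n : ℤ)⟧) → Prop
  | 0, _, _ => True
  | 1, _, _ => True
  | n + 2, B, α => ∃ (C : P.FullSubcategory) (β : A.obj ⟶ C.obj⟦((n + 1 : ℕ) : ℤ)⟧)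
      (γ : C.obj⟦((n + 1 : ℕ) : ℤ)⟧ ⟶ B.obj⟦((n + 2 : ℕ) : ℤ)⟧),
      FactorsThroughShifts (n + 1) β ∧ α = β ≫ γ

end YonedaTriangulated

open YonedaTriangulated

namespace YonedaTriangulated

section

variable {T : Type u} [Category.{v} T] [HasShift T ℤ]

lemma shiftedHom_comp_comp_shift {X Y Z W : T} {a b c : ℤ} (f : ShiftedHom X Y a)
    (g : ShiftedHom Y Z b) (h : b + a = c) (w : Z ⟶ W) :
    f.comp g h ≫ w⟦c⟧' = f.comp (g ≫ w⟦b⟧') h := by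
  rw [← ShiftedHom.comp_mk₀ (f.comp g h) 0 rfl w, ← ShiftedHom.comp_mk₀ g 0 rfl w,
    ShiftedHom.comp_assoc f g _ h (zero_add b) (by rw [zero_add, h])]

lemma shiftedHom_comp_shift_comp {X Y Z W : T} {a b c : ℤ} (f : ShiftedHom X Y a)
    (w : Y ⟶ Z) (g : ShiftedHom Z W b) (h : b + a = c) :
    ShiftedHom.comp (f ≫ w⟦a⟧') g h = f.comp (w ≫ g) h := by
  simp [ShiftedHom.comp]

lemma comp_shiftedHom_comp {X Y Z W : T} {a b c : ℤ} (w : X ⟶ Y) (f : ShiftedHom Y Z a)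
    (g : ShiftedHom Z W b) (h : b + a = c) :
    ShiftedHom.comp (w ≫ f) g h = w ≫ f.comp g h := by
  simp [ShiftedHom.comp]

end

variable {T : Type u} [Category.{v} T] [Preadditive T] [HasZeroObject T] [HasShift T ℤ]
  [∀ n : ℤ, (shiftFunctor T n).Additive] [Pretriangulated T] {P : ObjectProperty T}

namespace Conflation

/-- A lift along the shift `p[n]` of the deflation of a conflation. -/
lemma exists_eq_comp_shift_p {A B X : P.FullSubcategory} (c : Conflation B X A) {W : T} {n m : ℤ}
    (f : ShiftedHom W A.obj n) (h : 1 + n = m) (hf : f.comp c.δ h = 0) :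
    ∃ k : ShiftedHom W X.obj n, f = k ≫ c.p⟦n⟧' := by
  have h0 : f ≫ c.δ⟦n⟧' = 0 := by
    rw [ShiftedHom.comp, ← Category.assoc] at hf
    exact (cancel_mono ((shiftFunctorAdd' T 1 n m h).inv.app B.obj)).1 (hf.trans zero_comp.symm)
  obtain ⟨k, hk⟩ : ∃ k : W ⟶ X.obj⟦n⟧, f = k ≫ (n.negOnePow • c.p⟦n⟧') :=
    Triangle.coyoneda_exact₃ _ (Triangle.shift_distinguished _ c.distinguished n) f (by
      change f ≫ (n.negOnePow • c.δ⟦n⟧' ≫ (shiftFunctorComm T 1 n).hom.app B.obj) = 0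
      rw [Linear.comp_units_smul, reassoc_of% h0, zero_comp, smul_zero])
  exact ⟨n.negOnePow • k, by rw [hk]; simp⟩

variable [IsExactSubcategory P]

/-- A morphism of conflations is compatible with the connecting morphisms. -/
lemma δ_comp_shift {A B X A' B' X' : P.FullSubcategory} (c : Conflation B X A)
    (c' : Conflation B' X' A') {g : B.obj ⟶ B'.obj} {ψ : X.obj ⟶ X'.obj} {a : A.obj ⟶ A'.obj}
    (h₁ : c.i ≫ ψ = g ≫ c'.i) (h₂ : ψ ≫ c'.p = c.p ≫ a) :
    c.δ ≫ g⟦(1 : ℤ)⟧' = a ≫ c'.δ := by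
  obtain ⟨a', h₃, h₄⟩ : ∃ a' : A.obj ⟶ A'.obj, c.p ≫ a' = ψ ≫ c'.p ∧
      c.δ ≫ g⟦(1 : ℤ)⟧' = a' ≫ c'.δ :=
    complete_distinguished_triangle_morphism _ _ c.distinguished c'.distinguished g ψ h₁
  have : a' - a = 0 := c.eq_zero_of_p_comp _ (by
    rw [Preadditive.comp_sub, h₃, h₂, sub_self])
  rw [h₄, sub_eq_zero.1 this]

end Conflation

namespace NExtension

/-- A morphism of exact sequences `E ⟶ E'` which is `a` and `g` on the ends. The morphisms
`Cᵢ ⟶ C'ᵢ` that it induces are part of the data. -/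
def MapsOver {A A' : P.FullSubcategory} (a : A.obj ⟶ A'.obj) : {k : ℕ} →
    {B B' : P.FullSubcategory} → (B.obj ⟶ B'.obj) → NExtension k A B → NExtension k A' B' → Prop
  | _, _, _, g, single (X := X) c, single (X := X') c' =>
      ∃ ψ : X.obj ⟶ X'.obj, c.i ≫ ψ = g ≫ c'.i ∧ ψ ≫ c'.p = c.p ≫ a
  | _, _, _, g, cons (X := X) (C := C) c E, cons (X := X') (C := C') c' E' =>
      ∃ (ψ : X.obj ⟶ X'.obj) (φ : C.obj ⟶ C'.obj), c.i ≫ ψ = g ≫ c'.i ∧ ψ ≫ c'.p = c.p ≫ φ ∧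
        MapsOver a φ E E'

lemma nonempty [IsExactSubcategory P] (k : ℕ) (A B : P.FullSubcategory) :
    Nonempty (NExtension k A B) := by
  induction k with
  | zero =>
    obtain ⟨X, c, -⟩ := exists_conflation (0 : A.obj ⟶ B.obj⟦(1 : ℤ)⟧)
    exact ⟨single c⟩
  | succ k ih =>
    obtain ⟨X, c, -⟩ := exists_conflation (0 : B.obj ⟶ B.obj⟦(1 : ℤ)⟧)
    obtain ⟨E⟩ := ih
    exact ⟨cons c E⟩

namespace MapsOver

lemma congr {k : ℕ} {A A' B B' : P.FullSubcategory} {a a' : A.obj ⟶ A'.obj}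
    {g g' : B.obj ⟶ B'.obj} {E : NExtension k A B} {E' : NExtension k A' B'}
    (h : MapsOver a g E E') (ha : a = a') (hg : g = g') : MapsOver a' g' E E' := by
  rwa [← ha, ← hg]

lemma refl {k : ℕ} {A B : P.FullSubcategory} (E : NExtension k A B) :
    MapsOver (𝟙 A.obj) (𝟙 B.obj) E E := by
  induction E with
  | single c => exact ⟨𝟙 _, by simp, by simp⟩
  | cons c E ih => exact ⟨𝟙 _, 𝟙 _, by simp, by simp, ih⟩

lemma trans {k : ℕ} {A A' A'' B B' B'' : P.FullSubcategory} {a : A.obj ⟶ A'.obj}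
    {a' : A'.obj ⟶ A''.obj} {g : B.obj ⟶ B'.obj} {g' : B'.obj ⟶ B''.obj} {E : NExtension k A B}
    {E' : NExtension k A' B'} {E'' : NExtension k A'' B''} (h : MapsOver a g E E')
    (h' : MapsOver a' g' E' E'') : MapsOver (a ≫ a') (g ≫ g') E E'' := by
  induction E generalizing B' B'' with
  | single c =>
    cases E' with
    | single c' =>
    cases E'' with
    | single c'' =>
      obtain ⟨ψ, h₁, h₂⟩ := h
      obtain ⟨ψ', h₁', h₂'⟩ := h'
      exact ⟨ψ ≫ ψ', by rw [reassoc_of% h₁, h₁', Category.assoc],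
        by rw [Category.assoc, h₂', reassoc_of% h₂]⟩
  | cons c E ih =>
    cases E' with
    | cons c' E' =>
    cases E'' with
    | cons c'' E'' =>
      obtain ⟨ψ, φ, h₁, h₂, h₃⟩ := h
      obtain ⟨ψ', φ', h₁', h₂', h₃'⟩ := h'
      exact ⟨ψ ≫ ψ', φ ≫ φ', by rw [reassoc_of% h₁, h₁', Category.assoc],
        by rw [Category.assoc, h₂', reassoc_of% h₂], ih h₃ h₃'⟩

lemma mapsUnder {k : ℕ} {A B B' : P.FullSubcategory} {g : B.obj ⟶ B'.obj} {E : NExtension k A B}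
    {E' : NExtension k A B'} (h : MapsOver (𝟙 A.obj) g E E') {W : T} (w : W ⟶ B.obj) :
    MapsUnder E E' w (w ≫ g) := by
  induction E generalizing B' W with
  | single c =>
    cases E' with
    | single c' =>
      obtain ⟨ψ, h₁, h₂⟩ := h
      exact ⟨ψ, by rw [h₁, Category.assoc], by rw [h₂, Category.comp_id]⟩
  | cons c E ih =>
    cases E' with
    | cons c' E' =>
      obtain ⟨ψ, φ, h₁, h₂, h₃⟩ := h
      exact ⟨ψ, by rw [h₁, Category.assoc], by rw [h₂]; exact ih h₃ c.p⟩

lemma maps {k : ℕ} {A B : P.FullSubcategory} {E E' : NExtension k A B}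
    (h : MapsOver (𝟙 A.obj) (𝟙 B.obj) E E') : Maps E E' := by
  have := h.mapsUnder (𝟙 B.obj)
  rwa [Category.comp_id] at this

lemma mk_eq {k : ℕ} {A B : P.FullSubcategory} {E E' : NExtension k A B}
    (h : MapsOver (𝟙 A.obj) (𝟙 B.obj) E E') : YonedaExt.mk E = YonedaExt.mk E' :=
  Quot.sound h.maps

variable [IsExactSubcategory P]

lemma of_mapsUnder {k : ℕ} {A B B' W : P.FullSubcategory} {g : B.obj ⟶ B'.obj}
    {E : NExtension k A B} {E' : NExtension k A B'} (w : W.obj ⟶ B.obj)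
    (hw : ∀ {V : P.FullSubcategory} (f : B.obj ⟶ V.obj), w ≫ f = 0 → f = 0)
    (h : MapsUnder E E' w (w ≫ g)) : MapsOver (𝟙 A.obj) g E E' := by
  have cancel : ∀ {V : P.FullSubcategory} {f f' : B.obj ⟶ V.obj}, w ≫ f = w ≫ f' → f = f' :=
    fun hf => sub_eq_zero.1 (hw _ (by rw [Preadditive.comp_sub, hf, sub_self]))
  induction E generalizing B' W with
  | single c =>
    cases E' with
    | single c' =>
      obtain ⟨ψ, h₁, h₂⟩ := h
      exact ⟨ψ, cancel (by rw [h₁, Category.assoc]), by rw [h₂, Category.comp_id]⟩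
  | cons c E ih =>
    cases E' with
    | cons c' E' =>
      obtain ⟨ψ, h₁, h₂⟩ := h
      have h₁' : c.i ≫ ψ = g ≫ c'.i := cancel (by rw [h₁, Category.assoc])
      obtain ⟨φ, hφ⟩ := c.exists_eq_p_comp (ψ ≫ c'.p) (by
        rw [reassoc_of% h₁', c'.i_p, comp_zero])
      rw [hφ] at h₂
      have hp : ∀ {V : P.FullSubcategory} (f : _ ⟶ V.obj), c.p ≫ f = 0 → f = 0 :=
        fun f hf => c.eq_zero_of_p_comp f hf
      exact ⟨ψ, φ, h₁', hφ, ih c.p hp h₂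
        (fun hf => sub_eq_zero.1 (hp _ (by rw [Preadditive.comp_sub, hf, sub_self])))⟩

lemma of_maps {k : ℕ} {A B : P.FullSubcategory} {E E' : NExtension k A B} (h : Maps E E') :
    MapsOver (𝟙 A.obj) (𝟙 B.obj) E E' :=
  of_mapsUnder (𝟙 B.obj) (fun f hf => by rwa [Category.id_comp] at hf)
    (by rw [Category.id_comp]; exact h)

lemma toHom_comp {k : ℕ} {A A' B B' : P.FullSubcategory} {a : A.obj ⟶ A'.obj}
    {g : B.obj ⟶ B'.obj} {E : NExtension k A B} {E' : NExtension k A' B'}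
    (h : MapsOver a g E E') : E.toHom ≫ g⟦((k + 1 : ℕ) : ℤ)⟧' = a ≫ E'.toHom := by
  induction E generalizing B' with
  | single c =>
    cases E' with
    | single c' =>
      obtain ⟨ψ, h₁, h₂⟩ := h
      exact c.δ_comp_shift c' h₁ h₂
  | cons c E ih =>
    cases E' with
    | cons c' E' =>
      obtain ⟨ψ, φ, h₁, h₂, h₃⟩ := h
      rw [toHom, toHom, shiftedHom_comp_comp_shift, c.δ_comp_shift c' h₁ h₂,
        ← shiftedHom_comp_shift_comp, ih h₃, comp_shiftedHom_comp]

lemma to_push {k : ℕ} {A B C : P.FullSubcategory} (g : B.obj ⟶ C.obj) (E : NExtension k A B) :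
    MapsOver (𝟙 A.obj) g E (push g E) := by
  cases E with
  | single c => exact ⟨c.toPush g, c.i_toPush g, by rw [c.toPush_p, Category.comp_id]⟩
  | cons c E =>
    exact ⟨c.toPush g, 𝟙 _, c.i_toPush g, by rw [c.toPush_p, Category.comp_id], refl E⟩

lemma from_pull {k : ℕ} {A A' B : P.FullSubcategory} (a : A'.obj ⟶ A.obj)
    (E : NExtension k A B) : MapsOver a (𝟙 B.obj) (pull a E) E := by
  induction E with
  | single c => exact ⟨c.fromPull a, by rw [c.i_fromPull, Category.id_comp], c.fromPull_p a⟩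
  | cons c E ih => exact ⟨𝟙 _, 𝟙 _, by simp, by simp, ih a⟩

/-- A morphism of extensions factors through the pushout along its component on the left. -/
lemma push_left {k : ℕ} {A A' B B' C : P.FullSubcategory} {a : A.obj ⟶ A'.obj}
    {g : B.obj ⟶ C.obj} {g' : C.obj ⟶ B'.obj} {E : NExtension k A B} {E' : NExtension k A' B'}
    (h : MapsOver a (g ≫ g') E E') : MapsOver a g' (push g E) E' := by
  have key : ∀ {X X' D D' : P.FullSubcategory} (c : Conflation B X D) (c' : Conflation B' X' D')
      (ψ : X.obj ⟶ X'.obj) (φ : D.obj ⟶ D'.obj), c.i ≫ ψ = (g ≫ g') ≫ c'.i →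
      ψ ≫ c'.p = c.p ≫ φ → ∃ z : (c.pushObj g).obj ⟶ X'.obj, (c.push g).i ≫ z = g' ≫ c'.i ∧
        z ≫ c'.p = (c.push g).p ≫ φ := by
    intro X X' D D' c c' ψ φ h₁ h₂
    obtain ⟨z, hz₁, hz₂⟩ := c.push_exists_desc g (g' ≫ c'.i) ψ (by rw [h₁, Category.assoc])
    refine ⟨z, hz₁, c.push_hom_ext g ?_ ?_⟩
    · rw [reassoc_of% hz₁, c'.i_p, Conflation.i_p_assoc, comp_zero, zero_comp]
    · rw [reassoc_of% hz₂, c.toPush_p_assoc, h₂]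
  cases E with
  | single c =>
    cases E' with
    | single c' =>
      obtain ⟨ψ, h₁, h₂⟩ := h
      exact key c c' ψ a h₁ h₂
  | cons c E =>
    cases E' with
    | cons c' E' =>
      obtain ⟨ψ, φ, h₁, h₂, h₃⟩ := h
      obtain ⟨z, hz₁, hz₂⟩ := key c c' ψ φ h₁ h₂
      exact ⟨z, φ, hz₁, hz₂, h₃⟩

/-- A morphism of extensions factors through the pullback along its component on the right. -/
lemma pull_right {k : ℕ} {A A' A'' B B' : P.FullSubcategory} {a : A.obj ⟶ A'.obj}
    {a' : A'.obj ⟶ A''.obj} {g : B.obj ⟶ B'.obj} {E : NExtension k A B}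
    {E' : NExtension k A'' B'} (h : MapsOver (a ≫ a') g E E') : MapsOver a g E (pull a' E') := by
  induction E generalizing B' with
  | single c =>
    cases E' with
    | single c' =>
      obtain ⟨ψ, h₁, h₂⟩ := h
      obtain ⟨z, hz₁, hz₂⟩ := c'.pull_exists_lift a' (c.p ≫ a) ψ (by rw [h₂, Category.assoc])
      refine ⟨z, c'.pull_hom_ext a' ?_ ?_, hz₁⟩
      · rw [Category.assoc, Category.assoc, hz₁, Conflation.i_p, c.i_p_assoc, comp_zero, zero_comp]
      · rw [Category.assoc, Category.assoc, hz₂, h₁, Conflation.i_fromPull]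
  | cons c E ih =>
    cases E' with
    | cons c' E' =>
      obtain ⟨ψ, φ, h₁, h₂, h₃⟩ := h
      exact ⟨ψ, φ, h₁, h₂, ih h₃⟩

/-- A morphism of extensions which is the identity on `A` exhibits its target as a pushout. -/
lemma mk_push {k : ℕ} {A B B' : P.FullSubcategory} {g : B.obj ⟶ B'.obj} {E : NExtension k A B}
    {E' : NExtension k A B'} (h : MapsOver (𝟙 A.obj) g E E') :
    YonedaExt.mk (push g E) = YonedaExt.mk E' := by
  apply mk_eq
  apply push_left
  simpa using h

lemma dsum_fst {k : ℕ} {A B A' B' : P.FullSubcategory} (E : NExtension k A B)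
    (F : NExtension k A' B') :
    MapsOver (A := YonedaTriangulated.dsum A A') (B := YonedaTriangulated.dsum B B')
      biprod.fst biprod.fst (E.dsum F) E := by
  induction E generalizing B' with
  | single c =>
    cases F with
    | single d => exact ⟨biprod.fst, biprod.map_fst _ _, (biprod.map_fst _ _).symm⟩
  | cons c E ih =>
    cases F with
    | cons d F =>
      exact ⟨biprod.fst, biprod.fst, biprod.map_fst _ _, (biprod.map_fst _ _).symm, ih F⟩

lemma dsum_snd {k : ℕ} {A B A' B' : P.FullSubcategory} (E : NExtension k A B)
    (F : NExtension k A' B') :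
    MapsOver (A := YonedaTriangulated.dsum A A') (B := YonedaTriangulated.dsum B B')
      biprod.snd biprod.snd (E.dsum F) F := by
  induction E generalizing B' with
  | single c =>
    cases F with
    | single d => exact ⟨biprod.snd, biprod.map_snd _ _, (biprod.map_snd _ _).symm⟩
  | cons c E ih =>
    cases F with
    | cons d F =>
      exact ⟨biprod.snd, biprod.snd, biprod.map_snd _ _, (biprod.map_snd _ _).symm, ih F⟩

/-- Direct sums of extensions have the universal property of products with respect to
`MapsOver`. -/
lemma dsum_lift {k : ℕ} {A B A₁ B₁ A₂ B₂ : P.FullSubcategory} {a₁ : A.obj ⟶ A₁.obj}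
    {g₁ : B.obj ⟶ B₁.obj} {a₂ : A.obj ⟶ A₂.obj} {g₂ : B.obj ⟶ B₂.obj} {E : NExtension k A B}
    {E₁ : NExtension k A₁ B₁} {E₂ : NExtension k A₂ B₂} (h : MapsOver a₁ g₁ E E₁)
    (h' : MapsOver a₂ g₂ E E₂) :
    MapsOver (A' := YonedaTriangulated.dsum A₁ A₂) (B' := YonedaTriangulated.dsum B₁ B₂)
      (biprod.lift a₁ a₂) (biprod.lift g₁ g₂) E (E₁.dsum E₂) := by
  have key : ∀ {X Y X₁ X₂ Y₁ Y₂ : T} {r : X ⟶ Y} {s₁ : Y ⟶ Y₁} {s₂ : Y ⟶ Y₂} {t₁ : X ⟶ X₁}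
      {t₂ : X ⟶ X₂} {w₁ : X₁ ⟶ Y₁} {w₂ : X₂ ⟶ Y₂}, r ≫ s₁ = t₁ ≫ w₁ → r ≫ s₂ = t₂ ≫ w₂ →
      r ≫ biprod.lift s₁ s₂ = biprod.lift t₁ t₂ ≫ biprod.map w₁ w₂ := by
    intros
    ext <;> simp [*]
  induction E generalizing B₁ B₂ with
  | single c =>
    cases E₁ with
    | single c₁ =>
    cases E₂ with
    | single c₂ =>
      obtain ⟨ψ, h₁, h₂⟩ := h
      obtain ⟨φ, h₃, h₄⟩ := h'
      exact ⟨biprod.lift ψ φ, key h₁ h₃, (key h₂.symm h₄.symm).symm⟩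
  | cons c E ih =>
    cases E₁ with
    | cons c₁ E₁ =>
    cases E₂ with
    | cons c₂ E₂ =>
      obtain ⟨ψ, φ, h₁, h₂, h₃⟩ := h
      obtain ⟨ψ', φ', h₁', h₂', h₃'⟩ := h'
      exact ⟨biprod.lift ψ ψ', biprod.lift φ φ', key h₁ h₁', (key h₂.symm h₂'.symm).symm,
        ih h₃ h₃'⟩

end MapsOver

lemma toHom_splice {k l : ℕ} {A B C : P.FullSubcategory} (E : NExtension k A B)
    (F : NExtension l B C) :
    (splice E F).toHom = E.toHom.comp F.toHom (by push_cast; ring) := by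
  induction F with
  | single c => rfl
  | @cons l A B X C c F ih =>
    change (splice E F).toHom.comp c.δ _ = E.toHom.comp (F.toHom.comp c.δ _) _
    have h : (1 : ℤ) + ((l + 1 : ℕ) : ℤ) + ((k + 1 : ℕ) : ℤ) = ((k + 1 + (l + 1) + 1 : ℕ) : ℤ) := by
      push_cast
      ring
    rw [ih]
    exact ShiftedHom.comp_assoc _ _ _ _ _ h

lemma factorsThroughShifts_toHom {k : ℕ} {A B : P.FullSubcategory} (E : NExtension k A B) :
    FactorsThroughShifts (k + 1) E.toHom := by
  induction E with
  | single c => trivial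
  | cons c E ih => exact ⟨_, E.toHom, _, ih, rfl⟩

variable [IsExactSubcategory P]

/-- Two extensions of `A` by `B` are dominated by a common one. -/
lemma exists_mapsOver_pair {k : ℕ} {A B B' : P.FullSubcategory} (E : NExtension k A B)
    (F : NExtension k A B') : ∃ (D : P.FullSubcategory) (H : NExtension k A D)
      (g : D.obj ⟶ B.obj) (g' : D.obj ⟶ B'.obj),
      MapsOver (𝟙 A.obj) g H E ∧ MapsOver (𝟙 A.obj) g' H F := by
  have h := MapsOver.from_pull (A := YonedaTriangulated.dsum A A)
    (biprod.lift (𝟙 A.obj) (𝟙 A.obj)) (E.dsum F)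
  exact ⟨_, _, _, _,
    (h.trans (MapsOver.dsum_fst E F)).congr (biprod.lift_fst _ _) (Category.id_comp _),
    (h.trans (MapsOver.dsum_snd E F)).congr (biprod.lift_snd _ _) (Category.id_comp _)⟩

/-- The Baer sum of two extensions dominated by `H` is a pushout of `H`. -/
lemma baerSum_mk {k : ℕ} {A B D : P.FullSubcategory} {E F : NExtension k A B}
    {H : NExtension k A D} {g g' : D.obj ⟶ B.obj} (h : MapsOver (𝟙 A.obj) g H E)
    (h' : MapsOver (𝟙 A.obj) g' H F) :
    (YonedaExt.mk E).baerSum (YonedaExt.mk F) = YonedaExt.mk (push (g + g') H) := by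
  symm
  apply MapsOver.mk_push
  have h₁ := ((h.dsum_lift h').congr (Category.id_comp _).symm rfl).pull_right
  exact (h₁.trans (MapsOver.to_push _ _)).congr (Category.comp_id _)
    (by simp : biprod.lift g g' ≫ biprod.desc (𝟙 B.obj) (𝟙 B.obj) = g + g')

lemma mk_push_zero_eq {k : ℕ} {A B B' C : P.FullSubcategory} (E : NExtension k A B)
    (F : NExtension k A B') :
    YonedaExt.mk (push (0 : B.obj ⟶ C.obj) E) = YonedaExt.mk (push (0 : B'.obj ⟶ C.obj) F) := by
  obtain ⟨D, H, g, g', h, h'⟩ := exists_mapsOver_pair E F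
  have h₀ := (h.trans (MapsOver.to_push (0 : B.obj ⟶ C.obj) E))
  have h₁ := (h'.trans (MapsOver.to_push (0 : B'.obj ⟶ C.obj) F))
  rw [Category.comp_id, comp_zero] at h₀ h₁
  exact h₀.mk_push.symm.trans h₁.mk_push

/-- The class of an extension whose leftmost connecting morphism vanishes is zero. -/
lemma mk_cons_eq_push_zero {k : ℕ} {A B C X : P.FullSubcategory} (c : Conflation B X C)
    (hc : c.δ = 0) (E : NExtension k A C) :
    YonedaExt.mk (cons c E) = YonedaExt.mk (push (0 : B.obj ⟶ B.obj) (cons c E)) := by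
  obtain ⟨ψ, h₁, h₂⟩ := c.exists_map_of_δ (c.push (0 : B.obj ⟶ B.obj)) (𝟙 _) (𝟙 _)
    (by rw [c.push_δ, hc]; simp)
  exact MapsOver.mk_eq ⟨ψ, 𝟙 _, h₁, h₂, MapsOver.refl E⟩

lemma mk_cons_push {k : ℕ} {A B C D X : P.FullSubcategory} (c : Conflation B X C)
    (g : D.obj ⟶ C.obj) (E : NExtension k A D) :
    YonedaExt.mk (cons c (push g E)) = YonedaExt.mk (cons (c.pull g) E) :=
  Eq.symm <| MapsOver.mk_eq ⟨c.fromPull g, g, by rw [c.i_fromPull, Category.id_comp],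
    c.fromPull_p g, MapsOver.to_push g E⟩

lemma exists_toHom_eq {k : ℕ} {A B : P.FullSubcategory}
    (α : ShiftedHom A.obj B.obj ((k + 1 : ℕ) : ℤ)) (hα : FactorsThroughShifts (k + 1) α) :
    ∃ E : NExtension k A B, E.toHom = α := by
  induction k generalizing B with
  | zero =>
    obtain ⟨X, c, hc⟩ := exists_conflation (A := A) (B := B) α
    exact ⟨single c, hc⟩
  | succ k ih =>
    obtain ⟨C, β, γ, hβ, rfl⟩ := hα
    obtain ⟨E, rfl⟩ := ih β hβ
    have h : (1 : ℤ) + ((k + 1 : ℕ) : ℤ) = ((k + 2 : ℕ) : ℤ) := by push_cast; ring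
    obtain ⟨δ, hδ⟩ := (shiftFunctor T ((k + 1 : ℕ) : ℤ)).map_surjective
      (γ ≫ (shiftFunctorAdd' T 1 _ _ h).hom.app B.obj)
    obtain ⟨X, c, hc⟩ := exists_conflation (A := C) (B := B) δ
    refine ⟨cons c E, ?_⟩
    rw [toHom, ShiftedHom.comp, hc, hδ, Category.assoc, Iso.hom_inv_id_app, Category.comp_id]

end NExtension

namespace YonedaExt

lemma mk_surjective {k : ℕ} {A B : P.FullSubcategory} :
    Function.Surjective (mk : NExtension k A B → YonedaExt (k + 1) A B) :=
  Quot.mk_surjective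

lemma ofHom_surjective {A B : P.FullSubcategory} :
    Function.Surjective (ofHom : (A.obj ⟶ B.obj) → YonedaExt 0 A B) :=
  fun x => ⟨ULift.down x, rfl⟩

variable [IsExactSubcategory P]

/-- The map `Ext^n(A, B) ⟶ Hom(A, B[n])` given by the connecting morphisms of conflations. -/
noncomputable def toHom : (n : ℕ) → (A B : P.FullSubcategory) → YonedaExt n A B →
    ShiftedHom A.obj B.obj (n : ℤ)
  | 0, _, _, x => ShiftedHom.mk₀ _ Nat.cast_zero (ULift.down x)
  | _ + 1, _, _, x => Quot.lift NExtension.toHom (fun E E' h => by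
      have := (NExtension.MapsOver.of_maps h).toHom_comp
      rwa [CategoryTheory.Functor.map_id, Category.comp_id, Category.id_comp] at this) x

lemma toHom_mk {k : ℕ} {A B : P.FullSubcategory} (E : NExtension k A B) :
    toHom (k + 1) A B (mk E) = E.toHom := rfl

lemma range_toHom (n : ℕ) (A B : P.FullSubcategory) :
    Set.range (toHom n A B) = {α | FactorsThroughShifts n α} := by
  ext α
  cases n with
  | zero =>
    refine ⟨fun _ => trivial, fun _ => ?_⟩
    obtain ⟨φ, hφ⟩ := (ShiftedHom.homEquiv ((0 : ℕ) : ℤ) Nat.cast_zero).surjective α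
    exact ⟨ofHom φ, hφ⟩
  | succ k =>
    constructor
    · rintro ⟨x, rfl⟩
      obtain ⟨E, rfl⟩ := mk_surjective x
      exact E.factorsThroughShifts_toHom
    · intro hα
      obtain ⟨E, rfl⟩ := NExtension.exists_toHom_eq α hα
      exact ⟨mk E, rfl⟩

lemma toHom_push (n : ℕ) {A B C : P.FullSubcategory} (g : B.obj ⟶ C.obj) (x : YonedaExt n A B) :
    toHom n A C (x.push g) = toHom n A B x ≫ g⟦(n : ℤ)⟧' := by
  cases n with
  | zero =>
    change ShiftedHom.mk₀ ((0 : ℕ) : ℤ) Nat.cast_zero (ULift.down x ≫ g) =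
      ShiftedHom.mk₀ ((0 : ℕ) : ℤ) Nat.cast_zero (ULift.down x) ≫ g⟦((0 : ℕ) : ℤ)⟧'
    rw [← ShiftedHom.comp_mk₀ _ ((0 : ℕ) : ℤ) Nat.cast_zero, ShiftedHom.mk₀_comp_mk₀]
  | succ k =>
    obtain ⟨E, rfl⟩ := mk_surjective x
    exact ((NExtension.MapsOver.to_push g E).toHom_comp.trans (Category.id_comp _)).symm

lemma toHom_pull (n : ℕ) {A' A B : P.FullSubcategory} (a : A'.obj ⟶ A.obj) (x : YonedaExt n A B) :
    toHom n A' B (x.pull a) = a ≫ toHom n A B x := by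
  cases n with
  | zero => exact Category.assoc _ _ _
  | succ k =>
    obtain ⟨E, rfl⟩ := mk_surjective x
    have := (NExtension.MapsOver.from_pull a E).toHom_comp
    rwa [CategoryTheory.Functor.map_id, Category.comp_id] at this

lemma toHom_prod {n m k : ℕ} (h : n + m = k) {A B C : P.FullSubcategory} (x : YonedaExt n A B)
    (y : YonedaExt m B C) : toHom k A C (x.prod y h) =
      (toHom n A B x).comp (toHom m B C y) (by rw [← h]; push_cast; ring) := by
  match n, m, x, y with
  | n, 0, x, y =>
    obtain rfl : n = k := h
    rw [prod.eq_1]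
    refine (toHom_push _ _ x).trans ?_
    exact (ShiftedHom.comp_mk₀ _ _ Nat.cast_zero _).symm
  | 0, m + 1, x, y =>
    obtain rfl : m + 1 = k := by omega
    rw [prod.eq_2]
    refine (toHom_pull _ _ y).trans ?_
    exact (ShiftedHom.mk₀_comp _ Nat.cast_zero _ _).symm
  | n + 1, m + 1, x, y =>
    subst h
    obtain ⟨E, rfl⟩ := mk_surjective x
    obtain ⟨F, rfl⟩ := mk_surjective y
    exact NExtension.toHom_splice E F

/-! ### The group structure given by the Baer sum -/

instance (n : ℕ) (A B : P.FullSubcategory) : Nonempty (YonedaExt n A B) := by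
  cases n with
  | zero => exact ⟨ofHom 0⟩
  | succ k => exact (NExtension.nonempty k A B).map mk

lemma baerSum_ofHom {A B : P.FullSubcategory} (φ ψ : A.obj ⟶ B.obj) :
    (ofHom φ).baerSum (ofHom ψ) = ofHom (φ + ψ) := by
  have h : (biprod.lift (𝟙 A.obj) (𝟙 A.obj) ≫ biprod.map φ ψ) ≫
      biprod.desc (𝟙 B.obj) (𝟙 B.obj) = φ + ψ := by
    simp [biprod.map_eq]
  exact congrArg ofHom h

lemma push_ofHom {A B C : P.FullSubcategory} (φ : A.obj ⟶ B.obj) (g : B.obj ⟶ C.obj) :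
    push g (ofHom φ) = ofHom (φ ≫ g) := rfl

lemma push_mk {k : ℕ} {A B C : P.FullSubcategory} (g : B.obj ⟶ C.obj) (E : NExtension k A B) :
    push g (mk E) = mk (E.push g) := rfl

lemma baerSum_comm {n : ℕ} {A B : P.FullSubcategory} (x y : YonedaExt n A B) :
    x.baerSum y = y.baerSum x := by
  cases n with
  | zero =>
    obtain ⟨φ, rfl⟩ := ofHom_surjective x
    obtain ⟨ψ, rfl⟩ := ofHom_surjective y
    rw [baerSum_ofHom, baerSum_ofHom, add_comm]
  | succ k =>
    obtain ⟨E, rfl⟩ := mk_surjective x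
    obtain ⟨F, rfl⟩ := mk_surjective y
    obtain ⟨D, H, g, g', h, h'⟩ := E.exists_mapsOver_pair F
    rw [NExtension.baerSum_mk h h', NExtension.baerSum_mk h' h, add_comm g]

lemma baerSum_assoc {n : ℕ} {A B : P.FullSubcategory} (x y z : YonedaExt n A B) :
    (x.baerSum y).baerSum z = x.baerSum (y.baerSum z) := by
  cases n with
  | zero =>
    obtain ⟨φ, rfl⟩ := ofHom_surjective x
    obtain ⟨ψ, rfl⟩ := ofHom_surjective y
    obtain ⟨χ, rfl⟩ := ofHom_surjective z
    simp only [baerSum_ofHom, add_assoc]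
  | succ k =>
    obtain ⟨E, rfl⟩ := mk_surjective x
    obtain ⟨F, rfl⟩ := mk_surjective y
    obtain ⟨G, rfl⟩ := mk_surjective z
    obtain ⟨D, H, g₁, g₂, h₁, h₂⟩ := E.exists_mapsOver_pair F
    obtain ⟨D', H', q, g₃, hq, h₃⟩ := H.exists_mapsOver_pair G
    replace h₁ := hq.trans h₁
    replace h₂ := hq.trans h₂
    rw [Category.comp_id] at h₁ h₂
    rw [NExtension.baerSum_mk h₁ h₂, NExtension.baerSum_mk h₂ h₃,
      NExtension.baerSum_mk (NExtension.MapsOver.to_push _ _) h₃,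
      NExtension.baerSum_mk h₁ (NExtension.MapsOver.to_push _ _), add_assoc]

lemma push_zero_eq {n : ℕ} {A B : P.FullSubcategory} (x y : YonedaExt n A B) :
    x.push (0 : B.obj ⟶ B.obj) = y.push 0 := by
  cases n with
  | zero =>
    obtain ⟨φ, rfl⟩ := ofHom_surjective x
    obtain ⟨ψ, rfl⟩ := ofHom_surjective y
    rw [push_ofHom, push_ofHom, comp_zero, comp_zero]
  | succ k =>
    obtain ⟨E, rfl⟩ := mk_surjective x
    obtain ⟨F, rfl⟩ := mk_surjective y
    exact E.mk_push_zero_eq F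

lemma baerSum_push {n : ℕ} {A B : P.FullSubcategory} (g : B.obj ⟶ B.obj) (x : YonedaExt n A B) :
    x.baerSum (x.push g) = x.push (𝟙 B.obj + g) := by
  cases n with
  | zero =>
    obtain ⟨φ, rfl⟩ := ofHom_surjective x
    rw [push_ofHom, push_ofHom, baerSum_ofHom, Preadditive.comp_add, Category.comp_id]
  | succ k =>
    obtain ⟨E, rfl⟩ := mk_surjective x
    exact NExtension.baerSum_mk (NExtension.MapsOver.refl E) (NExtension.MapsOver.to_push g E)

lemma push_id {n : ℕ} {A B : P.FullSubcategory} (x : YonedaExt n A B) : x.push (𝟙 B.obj) = x := by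
  cases n with
  | zero => exact congrArg ULift.up (Category.comp_id _)
  | succ k =>
    obtain ⟨E, rfl⟩ := mk_surjective x
    exact (NExtension.MapsOver.refl E).mk_push

/-- The Baer sum makes `Ext^n(A, B)` an abelian group. -/
noncomputable abbrev addCommGroup (n : ℕ) (A B : P.FullSubcategory) :
    AddCommGroup (YonedaExt n A B) :=
  letI : Add (YonedaExt n A B) := ⟨baerSum⟩
  letI : Neg (YonedaExt n A B) := ⟨push (-𝟙 B.obj)⟩
  letI : Zero (YonedaExt n A B) := ⟨push (0 : B.obj ⟶ B.obj) (Classical.arbitrary _)⟩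
  { AddGroup.ofRightAxioms (G := YonedaExt n A B) baerSum_assoc
      (fun x => (congrArg (baerSum x) (push_zero_eq _ x)).trans
        ((baerSum_push 0 x).trans (by rw [add_zero, push_id])))
      (fun x => (baerSum_push _ x).trans (by rw [add_neg_cancel]; exact push_zero_eq _ _)) with
    add_comm := baerSum_comm }

lemma toHom_baerSum (n : ℕ) {A B : P.FullSubcategory} (x y : YonedaExt n A B) :
    toHom n A B (x.baerSum y) = toHom n A B x + toHom n A B y := by
  cases n with
  | zero =>
    obtain ⟨φ, rfl⟩ := ofHom_surjective x
    obtain ⟨ψ, rfl⟩ := ofHom_surjective y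
    rw [baerSum_ofHom]
    exact ShiftedHom.mk₀_add _ _ _ _
  | succ k =>
    obtain ⟨E, rfl⟩ := mk_surjective x
    obtain ⟨F, rfl⟩ := mk_surjective y
    obtain ⟨D, H, g, g', h, h'⟩ := E.exists_mapsOver_pair F
    have h₁ := h.toHom_comp
    have h₂ := h'.toHom_comp
    rw [Category.id_comp] at h₁ h₂
    rw [NExtension.baerSum_mk h h', ← push_mk, toHom_push, Functor.map_add, Preadditive.comp_add,
      toHom_mk, toHom_mk, toHom_mk, h₁, h₂]

/-! ### Injectivity -/

lemma eq_push_zero_of_toHom_eq_zero {n : ℕ} {A B : P.FullSubcategory}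
    (hA : ∀ B : P.FullSubcategory, Function.Bijective (toHom (n + 1) A B))
    (x : YonedaExt (n + 2) A B) (hx : toHom (n + 2) A B x = 0) :
    x = x.push (0 : B.obj ⟶ B.obj) := by
  obtain ⟨E, rfl⟩ := mk_surjective x
  cases E with
  | cons c E =>
    obtain ⟨β, hβ⟩ := c.exists_eq_comp_shift_p E.toHom _ hx
    obtain ⟨y, rfl⟩ := (hA _).2 β
    obtain ⟨F, rfl⟩ := mk_surjective y
    have hE : mk (F.push c.p) = mk E := (hA _).1 ((toHom_push _ _ (mk F)).trans hβ.symm)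
    have h : mk (.cons c E) = mk (.cons (c.pull c.p) F) := by
      rw [← NExtension.mk_cons_push c c.p F]
      exact congrArg (fun z => splice z (mk (.single c))) hE.symm
    rw [h]
    exact NExtension.mk_cons_eq_push_zero (c.pull c.p) (by rw [c.pull_δ, c.p_δ]) F

lemma toHom_succ_injective {n : ℕ} {A : P.FullSubcategory}
    (hA : ∀ B : P.FullSubcategory, Function.Bijective (toHom n A B)) (B : P.FullSubcategory) :
    Function.Injective (toHom (n + 1) A B) := by
  cases n with
  | zero =>
    intro x y hxy
    obtain ⟨E, rfl⟩ := mk_surjective x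
    obtain ⟨F, rfl⟩ := mk_surjective y
    cases E with
    | single c =>
    cases F with
    | single d =>
      have h : c.δ = d.δ := hxy
      obtain ⟨ψ, h₁, h₂⟩ := c.exists_map_of_δ d (𝟙 _) (𝟙 _) (by rw [h]; simp)
      exact NExtension.MapsOver.mk_eq ⟨ψ, h₁, h₂⟩
  | succ n =>
    let := addCommGroup (n + 2) A B
    let F : YonedaExt (n + 2) A B →+ ShiftedHom A.obj B.obj ((n + 2 : ℕ) : ℤ) :=
      AddMonoidHom.mk' (toHom (n + 2) A B) (toHom_baerSum _)
    exact (injective_iff_map_eq_zero F).2 fun x hx =>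
      (eq_push_zero_of_toHom_eq_zero hA x hx).trans (push_zero_eq _ _)

end YonedaExt

end YonedaTriangulated

theorem mainTheorem5 {T : Type u} [Category.{v} T] [Preadditive T] [HasZeroObject T]
    [HasShift T ℤ] [∀ n : ℤ, (shiftFunctor T n).Additive] [Pretriangulated T] [IsTriangulated T]
    (P : ObjectProperty T) [IsExactSubcategory P] :
    ∃ f : ∀ (n : ℕ) (A B : P.FullSubcategory), YonedaExt n A B → ShiftedHom A.obj B.obj (n : ℤ),
      -- the maps `f_n` are those induced by the connecting morphisms of the conflations
      (∀ (A B : P.FullSubcategory) (φ : A.obj ⟶ B.obj),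
        f 0 A B (YonedaExt.ofHom φ) = ShiftedHom.mk₀ ((0 : ℕ) : ℤ) Nat.cast_zero φ) ∧
      (∀ (k : ℕ) (A B : P.FullSubcategory) (E : NExtension k A B),
        f (k + 1) A B (YonedaExt.mk E) = E.toHom) ∧
      -- the image
      (∀ (n : ℕ) (A B : P.FullSubcategory),
        Set.range (f n A B) = {α | FactorsThroughShifts n α}) ∧
      -- Yoneda product is sent to composition
      (∀ (n m k : ℕ) (h : n + m = k) (A B C : P.FullSubcategory) (x : YonedaExt n A B)
        (y : YonedaExt m B C), f k A C (x.prod y h) =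
          (f n A B x).comp (f m B C y) (by rw [← h]; push_cast; ring)) ∧
      -- naturality in both variables
      (∀ (n : ℕ) (A B C : P.FullSubcategory) (g : B.obj ⟶ C.obj) (x : YonedaExt n A B),
        f n A C (x.push g) = f n A B x ≫ g⟦(n : ℤ)⟧') ∧
      (∀ (n : ℕ) (A' A B : P.FullSubcategory) (a : A'.obj ⟶ A.obj) (x : YonedaExt n A B),
        f n A' B (x.pull a) = a ≫ f n A B x) ∧
      -- the Baer sum is an abelian group structure, and `f_n` is a group homomorphism
      (∀ (n : ℕ) (A B : P.FullSubcategory), ∃ (_ : AddCommGroup (YonedaExt n A B))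
        (F : YonedaExt n A B →+ ShiftedHom A.obj B.obj (n : ℤ)),
        (∀ x y : YonedaExt n A B, x + y = x.baerSum y) ∧ ∀ x, F x = f n A B x) ∧
      -- if `f_{n-1,A,B}` is bijective for all `B`, then `f_{n,A,B}` is injective for all `B`
      (∀ (n : ℕ) (A : P.FullSubcategory),
        (∀ B : P.FullSubcategory, Function.Bijective (f n A B)) →
          ∀ B : P.FullSubcategory, Function.Injective (f (n + 1) A B)) ∧
      -- uniqueness
      (∀ g : ∀ (n : ℕ) (A B : P.FullSubcategory), YonedaExt n A B → ShiftedHom A.obj B.obj (n : ℤ),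
        (∀ (A B X : P.FullSubcategory) (c : Conflation B X A),
          g 1 A B (YonedaExt.mk (NExtension.single c)) = c.δ) →
        (∀ (n m k : ℕ) (h : n + m = k) (A B C : P.FullSubcategory) (x : YonedaExt n A B)
          (y : YonedaExt m B C), g k A C (x.prod y h) =
            (g n A B x).comp (g m B C y) (by rw [← h]; push_cast; ring)) →
        ∀ (n : ℕ), 1 ≤ n → ∀ (A B : P.FullSubcategory), g n A B = f n A B) := by
  refine ⟨YonedaExt.toHom, fun _ _ _ => rfl, fun _ _ _ _ => rfl, YonedaExt.range_toHom,
    fun _ _ _ h _ _ _ x y => YonedaExt.toHom_prod h x y,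
    fun n _ _ _ g x => YonedaExt.toHom_push n g x, fun n _ _ _ a x => YonedaExt.toHom_pull n a x,
    fun n A B => ?_, fun _ _ h => YonedaExt.toHom_succ_injective h, fun g h₁ h₂ n hn A B => ?_⟩
  · let := YonedaExt.addCommGroup n A B
    exact ⟨inferInstance, AddMonoidHom.mk' (YonedaExt.toHom n A B) (YonedaExt.toHom_baerSum n),
      fun _ _ => rfl, fun _ => rfl⟩
  · obtain ⟨k, rfl⟩ : ∃ k, n = k + 1 := ⟨n - 1, by omega⟩
    ext x
    obtain ⟨E, rfl⟩ := YonedaExt.mk_surjective x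
    induction E with
    | single c => exact h₁ _ _ _ c
    | @cons k A B X C c E ih =>
      have h := h₂ (k + 1) 1 (k + 2) rfl A C B (.mk E) (.mk (.single c))
      rw [ih (by omega), h₁] at h
      exact h
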